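/- Let $\Omega\subset\mathbb{C}^d$ be a domain (a nonempty connected open set) which is a $\mathcal{C}^0$ domain: every $x\in\partial\Omega$ has a neighborhood $U_x$, unitary coordinates $w=(w',w_d)\in\mathbb{C}^{d-1}\times\mathbb{C}$ centered at $x$, and a continuous real-valued function $\varphi_x$ on an open neighborhood of $0$ in $\mathbb{C}^{d-1}\times\mathbb{R}$ such that $U_x\cap\Omega$ is the set of points of $U_x$ with $\operatorname{Im} w_d>\varphi_x(w',\operatorname{Re} w_d)$. Let $K_\Omega$ be the Kobayashi pseudo-distance of $\Omega$. Suppose that $\Omega$ is Kobayashi hyperbolic (i.e. $K_\Omega$ is a distance) and that $(\Omega,K_\Omega)$ is Gromov hyperbolic: with $(x|y)_o=\frac12\big(K_\Omega(o,x)+K_\Omega(o,y)-K_\Omega(x,y)\big)$, there is $\delta\ge 0$ such that $\min\{(a|b)_o,(b|c)_o\}\le (a|c)_o+\delta$ for all $a,b,c,o\in\Omega$. Let $\partial_G\Omega$ be the Gromov boundary of $(\Omega,K_\Omega)$, i.e. the set of classes of sequences $(x_n)$ in $\Omega$ with $(x_m|x_n)_o\to\infty$ as $m,n\to\infty$, where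 $(x_n)\sim(y_n)$ iff $(x_m|y_n)_o\to\infty$. Extend the Gromov product to $\Omega\cup\partial_G\Omega$ by $(p|q)_o=\inf\liminf_{m,n\to\infty}(x_m|y_n)_o$, the infimum being over sequences $(x_m)$, $(y_n)$ representing $p$, $q$ (a point of $\Omega$ being represented by the constant sequence only), and call $S\subset\Omega\cup\partial_G\Omega$ open if $S\cap\Omega$ is open for $K_\Omega$ and for each $\xi\in S\cap\partial_G\Omega$ there is $t\ge 0$ with $\{p:(p|\xi)_o>t\}\subset S$. Let $\overline{\Omega}^{End}$ be the end (Freudenthal) compactification of the closure $\overline\Omega$: it consists of $\overline\Omega$ and its ends, an end $e$ being a choice, decreasing in $K$, of a connected component $e(K)$ of $\overline\Omega\setminus K$ for every compact $K\subset\overline\Omega$; a set is open if its intersection with $\overline\Omega$ is open in $\overline\Omega$ and with every end $e$ it contains, for some compact $K$, the set $e(K)$ and all ends $e'$ with $e'(K)=e(K)$. Suppose that the identity map of $\Omega$ extends to a homeomorphism from $\Omega\cup\partial_G\Omega$ onto $\overline{\Omega}^{End}$. Then $\partial\Omega$ contains no germ of a complex variety of positive dimension: there are no open set $U\subset\mathbb{C}^d$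 and complex analytic subvariety $V$ of $U$ with $\dim V>0$ and $V\subset\partial\Omega$. Here $\dim V$ is the largest dimension of $V$ at one of its regular points, i.e. points near which $V$ is a complex submanifold. -/

import Mathlib

open Set Filter Topology

noncomputable section

/-- Complex Euclidean space `ℂ^d` with the standard Hermitian inner product. -/
abbrev Cn (d : ℕ) : Type := EuclideanSpace ℂ (Fin d)

/-- A domain in `ℂ^d`: a nonempty connected open subset. -/
def IsDomainIn {d : ℕ} (Ω : Set (Cn d)) : Prop := IsOpen Ω ∧ IsConnected Ω

/-! ### The Kobayashi pseudo-distance -/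

/-- The Poincaré distance on the open unit disc, i.e. the distance of the metric
`|dζ| / (1 - |ζ|²)`. -/
def poincareDist (a b : ℂ) : ℝ :=
  Real.artanh (‖a - b‖ / ‖1 - (starRingEnd ℂ) a * b‖)

/-- `f` restricts to a holomorphic map from the open unit disc to `Ω`. -/
def IsHolomorphicDisc {d : ℕ} (Ω : Set (Cn d)) (f : ℂ → Cn d) : Prop :=
  DifferentiableOn ℂ f (Metric.ball 0 1) ∧ MapsTo f (Metric.ball 0 1) Ω

/-- `L` is the total Poincaré length of a chain of holomorphic discs in `Ω` joining `z` to `w`. -/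
def IsDiscChainLength {d : ℕ} (Ω : Set (Cn d)) (z w : Cn d) (L : ℝ) : Prop :=
  ∃ (n : ℕ) (p : ℕ → Cn d) (f : ℕ → ℂ → Cn d) (a b : ℕ → ℂ),
    p 0 = z ∧ p n = w ∧
    (∀ j < n, IsHolomorphicDisc Ω (f j) ∧
      a j ∈ Metric.ball (0 : ℂ) 1 ∧ b j ∈ Metric.ball (0 : ℂ) 1 ∧
      f j (a j) = p j ∧ f j (b j) = p (j + 1)) ∧
    L = ∑ j ∈ Finset.range n, poincareDist (a j) (b j)

/-- The Kobayashi pseudo-distance `K_Ω` of a domain `Ω`. Since `Ω` is open and connected, any two of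
its points are joined by a chain of discs, so the infimum is over a nonempty set of nonnegative
numbers. -/
def kobayashiDist {d : ℕ} (Ω : Set (Cn d)) (z w : Ω) : ℝ :=
  sInf {L : ℝ | IsDiscChainLength Ω z w L}

/-- `Ω` is Kobayashi hyperbolic: `K_Ω` is a distance (it is always a pseudo-distance). -/
def IsKobayashiHyperbolic {d : ℕ} (Ω : Set (Cn d)) : Prop :=
  ∀ z w : Ω, kobayashiDist Ω z w = 0 → z = w

/-! ### `C⁰` domains -/

/-- Every boundary point `x` has a neighbourhood `U` and unitary coordinates
`Ψ (z - x) = (w', w_d) ∈ ℂ^(d-1) × ℂ` centred at `x` in which `U ∩ Ω` is the set of points of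
(the image of) `U` with `Im w_d > φ (w', Re w_d)`, for a continuous real function `φ` on an open
neighbourhood `N` of `0` in `ℂ^(d-1) × ℝ`. (For `d = 0` the boundary is empty.) -/
def IsC0Domain {d : ℕ} (Ω : Set (Cn d)) : Prop :=
  IsDomainIn Ω ∧ ∀ x ∈ frontier Ω,
    ∃ (U : Set (Cn d)) (Ψ : Cn d ≃ₗᵢ[ℂ] WithLp 2 (Cn (d - 1) × ℂ))
      (N : Set (Cn (d - 1) × ℝ)) (φ : Cn (d - 1) × ℝ → ℝ),
      IsOpen U ∧ x ∈ U ∧ IsOpen N ∧ (0, 0) ∈ N ∧ ContinuousOn φ N ∧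
      ∀ z ∈ U, ((Ψ (z - x)).fst, (Ψ (z - x)).snd.re) ∈ N ∧
        (z ∈ Ω ↔ φ ((Ψ (z - x)).fst, (Ψ (z - x)).snd.re) < (Ψ (z - x)).snd.im)

/-! ### Gromov hyperbolicity and the Gromov compactification

In this section `dist` is a distance function on the set `X`. -/

section Gromov

variable {X : Type*}

/-- The Gromov product `(x | y)_o`. -/
def gromovProd (dist : X → X → ℝ) (o x y : X) : ℝ :=
  (dist o x + dist o y - dist x y) / 2

/-- Gromov hyperbolicity (four-point condition). -/
def IsGromovHyperbolic (dist : X → X → ℝ) : Prop :=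
  ∃ δ : ℝ, 0 ≤ δ ∧ ∀ a b c o : X,
    min (gromovProd dist o a b) (gromovProd dist o b c) ≤ gromovProd dist o a c + δ

/-- `(x_m | y_n)_o → ∞` as `m, n → ∞`; independent of the base point `o`. -/
def GromovEquiv (dist : X → X → ℝ) (x y : ℕ → X) : Prop :=
  ∀ o : X, Tendsto (fun m : ℕ × ℕ => gromovProd dist o (x m.1) (y m.2)) atTop atTop

/-- Gromov sequences. -/
def IsGromovSeq (dist : X → X → ℝ) (x : ℕ → X) : Prop := GromovEquiv dist x x

/-- The Gromov boundary: the set of equivalence classes of Gromov sequences. -/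
def GromovBoundary (dist : X → X → ℝ) : Type _ :=
  {C : Set (ℕ → X) // ∃ x, IsGromovSeq dist x ∧
    C = {y | IsGromovSeq dist y ∧ GromovEquiv dist x y}}

/-- The Gromov compactification, as a set: `X` together with its Gromov boundary. -/
inductive GromovCompactification (dist : X → X → ℝ) : Type _
  | of (x : X) : GromovCompactification dist
  | bdry (ξ : GromovBoundary dist) : GromovCompactification dist

namespace GromovCompactification

variable {dist : X → X → ℝ}

/-- The sequences representing a point: the constant sequence for a point of `X`, the members of
the equivalence class for a boundary point. -/
def reps : GromovCompactification dist → Set (ℕ → X)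
  | of x => {fun _ => x}
  | bdry ξ => ξ.1

/-- The extended Gromov product, `inf liminf_{m,n} (x_m | y_n)_o` over representing sequences. -/
def prod (o : X) (p q : GromovCompactification dist) : EReal :=
  ⨅ x ∈ reps p, ⨅ y ∈ reps q,
    liminf (fun m : ℕ × ℕ => ((gromovProd dist o (x m.1) (y m.2) : ℝ) : EReal)) atTop

/-- A set `S` is open iff `S ∩ X` is open for `dist`, and with every boundary point `ξ` it contains
a set `{p | (p | ξ)_o > t}`. -/
instance : TopologicalSpace (GromovCompactification dist) where
  IsOpen S :=
    (∀ x : X, of x ∈ S → ∃ ε > 0, ∀ y : X, dist x y < ε → of y ∈ S) ∧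
    (∀ ξ : GromovBoundary dist, bdry ξ ∈ S → ∀ o : X, ∃ t : ℝ, 0 ≤ t ∧
      ∀ p : GromovCompactification dist, (t : EReal) < prod o p (bdry ξ) → p ∈ S)
  isOpen_univ := ⟨fun _ _ => ⟨1, one_pos, fun _ _ => mem_univ _⟩,
    fun _ _ _ => ⟨0, le_rfl, fun _ _ => mem_univ _⟩⟩
  isOpen_inter := by
    rintro S T ⟨hS, hS'⟩ ⟨hT, hT'⟩
    refine ⟨fun x hx => ?_, fun ξ hξ o => ?_⟩
    · obtain ⟨ε, hε, h⟩ := hS x hx.1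
      obtain ⟨ε', hε', h'⟩ := hT x hx.2
      exact ⟨min ε ε', lt_min hε hε', fun y hy =>
        ⟨h y (hy.trans_le (min_le_left _ _)), h' y (hy.trans_le (min_le_right _ _))⟩⟩
    · obtain ⟨t, ht, h⟩ := hS' ξ hξ.1 o
      obtain ⟨t', _, h'⟩ := hT' ξ hξ.2 o
      refine ⟨max t t', ht.trans (le_max_left _ _), fun p hp => ⟨h p ?_, h' p ?_⟩⟩
      · exact lt_of_le_of_lt (EReal.coe_le_coe_iff.2 (le_max_left _ _)) hp
      · exact lt_of_le_of_lt (EReal.coe_le_coe_iff.2 (le_max_right _ _)) hp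
  isOpen_sUnion := by
    intro 𝒮 h𝒮
    refine ⟨?_, ?_⟩
    · rintro x ⟨S, hS, hx⟩
      obtain ⟨ε, hε, h⟩ := (h𝒮 S hS).1 x hx
      exact ⟨ε, hε, fun y hy => ⟨S, hS, h y hy⟩⟩
    · rintro ξ ⟨S, hS, hξ⟩ o
      obtain ⟨t, ht, h⟩ := (h𝒮 S hS).2 ξ hξ o
      exact ⟨t, ht, fun p hp => ⟨S, hS, h p hp⟩⟩

end GromovCompactification

end Gromov

/-! ### The end compactification -/

section Ends

open TopologicalSpace (Compacts)

/-- An end of `Y`: a choice, for every compact `K ⊆ Y`, of a connected component of `Y \ K`,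
decreasing in `K`. (If `Y` has an exhaustion by compact sets `K_n` whose interiors cover `Y`, an end
is determined by its values on the `K_n`, and these can be any decreasing sequence of
components.) -/
def SpaceEnd (Y : Type*) [TopologicalSpace Y] : Type _ :=
  {e : Compacts Y → Set Y //
    (∀ K : Compacts Y, ∃ y ∈ (K : Set Y)ᶜ, e K = connectedComponentIn (K : Set Y)ᶜ y) ∧
    ∀ K L : Compacts Y, K ≤ L → e L ⊆ e K}

/-- The end compactification of `Y`, as a set: `Y` together with its ends. -/
inductive EndCompactification (Y : Type*) [TopologicalSpace Y] : Type _
  | of (y : Y) : EndCompactification Y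
  | atEnd (e : SpaceEnd Y) : EndCompactification Y

namespace EndCompactification

variable {Y : Type*} [TopologicalSpace Y]

/-- The neighbourhood of the end `e` given by the compact set `K`: the component `e K` of `Y \ K`
and all the ends lying in it. -/
def endNhd (e : SpaceEnd Y) (K : Compacts Y) : Set (EndCompactification Y) :=
  of '' (e.1 K) ∪ atEnd '' {e' : SpaceEnd Y | e'.1 K = e.1 K}

theorem endNhd_anti (e : SpaceEnd Y) {K L : Compacts Y} (h : K ≤ L) :
    endNhd e L ⊆ endNhd e K := by
  rintro _ (⟨y, hy, rfl⟩ | ⟨e', he', rfl⟩)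
  · exact Or.inl ⟨y, e.2.2 K L h hy, rfl⟩
  · refine Or.inr ⟨e', ?_, rfl⟩
    obtain ⟨y, hy, hey⟩ := e.2.1 L
    have hyL : y ∈ e.1 L := by rw [hey]; exact mem_connectedComponentIn hy
    have h1 : y ∈ e.1 K := e.2.2 K L h hyL
    have h2 : y ∈ e'.1 K := e'.2.2 K L h (by rw [he']; exact hyL)
    obtain ⟨a, _, ha⟩ := e.2.1 K
    obtain ⟨b, _, hb⟩ := e'.2.1 K
    rw [ha] at h1
    rw [hb] at h2
    change e'.1 K = e.1 K
    rw [ha, hb, connectedComponentIn_eq h1, connectedComponentIn_eq h2]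

/-- A set `S` is open iff `S ∩ Y` is open in `Y` and `S` contains, with every end `e`, one of the
neighbourhoods `endNhd e K`. -/
instance : TopologicalSpace (EndCompactification Y) where
  IsOpen S := IsOpen {y : Y | of y ∈ S} ∧
    ∀ e : SpaceEnd Y, atEnd e ∈ S → ∃ K : Compacts Y, endNhd e K ⊆ S
  isOpen_univ := ⟨by simp, fun _ _ => ⟨⊥, subset_univ _⟩⟩
  isOpen_inter := by
    rintro S T ⟨hS, hS'⟩ ⟨hT, hT'⟩
    refine ⟨hS.inter hT, fun e he => ?_⟩
    obtain ⟨K, hK⟩ := hS' e he.1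
    obtain ⟨L, hL⟩ := hT' e he.2
    exact ⟨K ⊔ L, subset_inter ((endNhd_anti e le_sup_left).trans hK)
      ((endNhd_anti e le_sup_right).trans hL)⟩
  isOpen_sUnion := by
    intro 𝒮 h𝒮
    refine ⟨?_, ?_⟩
    · have : {y : Y | of y ∈ ⋃₀ 𝒮} = ⋃ S ∈ 𝒮, {y : Y | of y ∈ S} := by
        ext y
        simp
      rw [this]
      exact isOpen_biUnion fun S hS => (h𝒮 S hS).1
    · rintro e ⟨S, hS, he⟩
      obtain ⟨K, hK⟩ := (h𝒮 S hS).2 e he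
      exact ⟨K, hK.trans (subset_sUnion_of_mem hS)⟩

end EndCompactification

end Ends

/-- The identity map of `Ω` extends to a homeomorphism from the Gromov compactification of
`(Ω, K_Ω)` onto the end compactification of the closure of `Ω`. -/
def IdExtendsGromovToEnd {d : ℕ} (Ω : Set (Cn d)) : Prop :=
  ∃ h : GromovCompactification (kobayashiDist Ω) ≃ₜ EndCompactification (closure Ω),
    ∀ z : Ω, h (GromovCompactification.of z) =
      EndCompactification.of ⟨z.1, subset_closure z.2⟩

/-! ### Complex varieties -/

/-- `A` is a complex (analytic) subvariety of the open set `U`: locally in `U`, it is the set of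
common zeros of finitely many holomorphic functions. -/
def IsComplexSubvariety {d : ℕ} (U A : Set (Cn d)) : Prop :=
  IsOpen U ∧ A ⊆ U ∧ ∀ p ∈ U, ∃ W : Set (Cn d), IsOpen W ∧ p ∈ W ∧ W ⊆ U ∧
    ∃ (n : ℕ) (f : Fin n → Cn d → ℂ), (∀ i, DifferentiableOn ℂ (f i) W) ∧
      ∀ z ∈ W, z ∈ A ↔ ∀ i, f i z = 0

/-- `p` is a regular point of `A` of dimension `k`: near `p`, the set `A` is a `k`-dimensional
complex submanifold, i.e. a biholomorphic map `Φ` between open subsets of `ℂ^d`, defined near `p`,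
takes `A` to a `k`-dimensional linear subspace. -/
def IsRegularPointOfDim {d : ℕ} (A : Set (Cn d)) (p : Cn d) (k : ℕ) : Prop :=
  p ∈ A ∧ ∃ (Φ : OpenPartialHomeomorph (Cn d) (Cn d)) (L : Submodule ℂ (Cn d)),
    p ∈ Φ.source ∧ DifferentiableOn ℂ Φ Φ.source ∧ DifferentiableOn ℂ Φ.symm Φ.target ∧
    Module.finrank ℂ L = k ∧ ∀ z ∈ Φ.source, z ∈ A ↔ Φ z ∈ L

/-- The dimension of a complex variety: the supremum of the dimensions at its regular points
(which form a dense subset of it); `⊥` for the empty variety. -/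
def varietyDim {d : ℕ} (A : Set (Cn d)) : WithBot ℕ∞ :=
  ⨆ (p : Cn d) (k : ℕ) (_ : IsRegularPointOfDim A p k), ((k : ℕ∞) : WithBot ℕ∞)

end

/-! A variety of positive dimension in `frontier Ω` contains a nonconstant holomorphic disc `g` near
a regular point (`exists_disc_of_varietyDim_pos`). The boundary is locally a graph, so small
translations in one fixed direction push this disc into `Ω`
(`IsC0Domain.exists_inward_translation`). Since holomorphic discs do not increase distance, the
translates of `g 0` and `g (1 / 2)` stay at Kobayashi distance at most `poincareDist (1 / 2) 0`,
while they converge to two different boundary points.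

The homeomorphism forbids this: sequences at bounded distance have Gromov products with any boundary
point that differ by a bounded amount, so they cannot have different limits once one of them
converges to a Gromov boundary point (`GromovCompactification.tendsto_of_dist_le`, transported to
`closure Ω` by `IdExtendsGromovToEnd.limit_eq`). -/

/-! ### The Kobayashi pseudo-distance -/

theorem poincareDist_nonneg (a b : ℂ) : 0 ≤ poincareDist a b :=
  Real.artanh_nonneg (by positivity)

theorem IsDiscChainLength.nonneg {d : ℕ} {Ω : Set (Cn d)} {z w : Cn d} {L : ℝ}
    (h : IsDiscChainLength Ω z w L) : 0 ≤ L := by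
  obtain ⟨n, p, f, a, b, -, -, -, rfl⟩ := h
  exact Finset.sum_nonneg fun _ _ => poincareDist_nonneg _ _

theorem IsHolomorphicDisc.isDiscChainLength {d : ℕ} {Ω : Set (Cn d)} {f : ℂ → Cn d}
    (hf : IsHolomorphicDisc Ω f) {a b : ℂ} (ha : a ∈ Metric.ball (0 : ℂ) 1)
    (hb : b ∈ Metric.ball (0 : ℂ) 1) :
    IsDiscChainLength Ω (f a) (f b) (poincareDist a b) :=
  ⟨1, fun j => if j = 0 then f a else f b, fun _ => f, fun _ => a, fun _ => b, by simp, by simp,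
    fun j hj => by obtain rfl : j = 0 := by omega
                   exact ⟨hf, ha, hb, by simp, by simp⟩, by simp⟩

theorem IsDiscChainLength.trans {d : ℕ} {Ω : Set (Cn d)} {x y z : Cn d} {L M : ℝ}
    (h₁ : IsDiscChainLength Ω x y L) (h₂ : IsDiscChainLength Ω y z M) :
    IsDiscChainLength Ω x z (L + M) := by
  obtain ⟨n, p, f, a, b, hp0, hpn, hj, rfl⟩ := h₁
  obtain ⟨m, q, g, a', b', hq0, hqm, hj', rfl⟩ := h₂
  refine ⟨n + m, fun j => if j < n then p j else q (j - n),
    fun j => if j < n then f j else g (j - n), fun j => if j < n then a j else a' (j - n),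
    fun j => if j < n then b j else b' (j - n), ?_, by simpa using hqm, fun j hjn => ?_, ?_⟩
  · rcases Nat.eq_zero_or_pos n with rfl | hn
    · simp [hq0, ← hpn, hp0]
    · simp [hn, hp0]
  · by_cases h : j < n
    · obtain ⟨h1, h2, h3, h4, h5⟩ := hj j h
      refine ⟨by simpa [h] using h1, by simpa [h] using h2, by simpa [h] using h3,
        by simpa [h] using h4, ?_⟩
      by_cases h' : j + 1 < n
      · simpa [h, h'] using h5
      · obtain rfl : n = j + 1 := by omega
        simp [h5, hpn, hq0]
    · obtain ⟨h1, h2, h3, h4, h5⟩ := hj' (j - n) (by omega)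
      have h' : ¬ j + 1 < n := by omega
      have h'' : j + 1 - n = j - n + 1 := by omega
      simp only [h, h', h'', if_false]
      exact ⟨h1, h2, h3, h4, h5⟩
  · rw [Finset.sum_range_add]
    congr 1
    · exact Finset.sum_congr rfl fun j hj => by simp [Finset.mem_range.1 hj]
    · exact Finset.sum_congr rfl fun j _ => by simp

/-- Nearby points lie on a common affine disc, and connectedness chains these discs together. The
triangle inequality needs this, because `sInf ∅ = 0` in `ℝ`. -/
theorem IsDomainIn.exists_isDiscChainLength {d : ℕ} {Ω : Set (Cn d)} (hΩ : IsDomainIn Ω)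
    {z w : Cn d} (hz : z ∈ Ω) (hw : w ∈ Ω) : ∃ L, IsDiscChainLength Ω z w L := by
  refine hΩ.2.isPreconnected.induction₂' (fun z w => ∃ L, IsDiscChainLength Ω z w L)
    (fun x hx => ?_) (fun x y z _ _ _ => ?_) hz hw
  · obtain ⟨r, hr, hball⟩ := Metric.isOpen_iff.1 hΩ.1 x hx
    filter_upwards [mem_nhdsWithin_of_mem_nhds (Metric.ball_mem_nhds x (half_pos hr))] with y hy
    -- The factor `2` puts `y` at the interior parameter `1 / 2`; the radius `r / 2` for `y`
    -- compensates for it.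
    have hf : IsHolomorphicDisc Ω fun ζ : ℂ => x + (2 * ζ) • (y - x) := by
      refine ⟨by fun_prop, fun ζ hζ => hball ?_⟩
      rw [mem_ball_zero_iff] at hζ
      rw [mem_ball_iff_norm] at hy ⊢
      rw [add_sub_cancel_left, norm_smul, norm_mul, Complex.norm_ofNat]
      nlinarith [norm_nonneg (y - x), norm_nonneg ζ]
    have h0 : (0 : ℂ) ∈ Metric.ball (0 : ℂ) 1 := by simp
    have h1 : (1 / 2 : ℂ) ∈ Metric.ball (0 : ℂ) 1 := by norm_num
    have key₁ := hf.isDiscChainLength h0 h1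
    have key₂ := hf.isDiscChainLength h1 h0
    simp only [mul_zero, zero_smul, add_zero, mul_one_div_cancel (two_ne_zero' ℂ), one_smul,
      add_sub_cancel] at key₁ key₂
    exact ⟨⟨_, key₁⟩, ⟨_, key₂⟩⟩
  · rintro ⟨L, hL⟩ ⟨M, hM⟩
    exact ⟨_, hL.trans hM⟩

theorem kobayashiDist_le {d : ℕ} {Ω : Set (Cn d)} {z w : Ω} {L : ℝ}
    (h : IsDiscChainLength Ω z w L) : kobayashiDist Ω z w ≤ L :=
  csInf_le ⟨0, fun _ h => h.nonneg⟩ h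

theorem IsDomainIn.kobayashiDist_triangle {d : ℕ} {Ω : Set (Cn d)} (hΩ : IsDomainIn Ω)
    (x y z : Ω) : kobayashiDist Ω x z ≤ kobayashiDist Ω x y + kobayashiDist Ω y z := by
  have h (u v : Ω) : {L : ℝ | IsDiscChainLength Ω u v L}.Nonempty :=
    hΩ.exists_isDiscChainLength u.2 v.2
  refine le_of_forall_pos_lt_add fun ε hε => ?_
  obtain ⟨L, hL, hL'⟩ := exists_lt_of_csInf_lt (h x y) (lt_add_of_pos_right _ (half_pos hε))
  obtain ⟨M, hM, hM'⟩ := exists_lt_of_csInf_lt (h y z) (lt_add_of_pos_right _ (half_pos hε))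
  have := kobayashiDist_le (IsDiscChainLength.trans hL hM)
  unfold kobayashiDist at *
  linarith

/-! ### Sequences at bounded distance in the Gromov compactification -/

section Gromov

variable {X : Type*} {dist : X → X → ℝ}

/-- Both triangle inequalities involve `dist y x` in this order, so symmetry of `dist` is not
needed. -/
theorem gromovProd_le_add (htri : ∀ x y z, dist x z ≤ dist x y + dist y z) {o x y z : X} {C : ℝ}
    (h : dist y x ≤ C) : gromovProd dist o x z ≤ gromovProd dist o y z + C := by
  have h₁ := htri o y x
  have h₂ := htri y x z
  unfold gromovProd
  linarith

theorem GromovCompactification.prod_of_le_add (htri : ∀ x y z, dist x z ≤ dist x y + dist y z)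
    {o x y : X} {C : ℝ} (h : dist y x ≤ C) (q : GromovCompactification dist) {t : ℝ}
    (ht : ((t + C : ℝ) : EReal) < prod o (of x) q) : (t : EReal) ≤ prod o (of y) q := by
  simp only [prod, reps, mem_singleton_iff, iInf_iInf_eq_left] at ht ⊢
  refine le_iInf₂ fun u hu => ?_
  have hlt := eventually_lt_of_lt_liminf (ht.trans_le (iInf₂_le u hu))
  refine le_liminf_of_le (by isBoundedDefault) ?_
  filter_upwards [hlt] with m hm
  rw [EReal.coe_lt_coe_iff] at hm
  rw [EReal.coe_le_coe_iff]
  linarith [gromovProd_le_add htri (o := o) (z := u m.2) h]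

/-- If `x n` converges to a Gromov boundary point and `y n` stays at bounded distance of `x n`, then
`y n` has the same limit, provided that the subsequences of `x` accumulate nowhere else. -/
theorem GromovCompactification.tendsto_of_dist_le
    (htri : ∀ x y z, dist x z ≤ dist x y + dist y z) {x y : ℕ → X} {C : ℝ}
    (hC : ∀ n, dist (y n) (x n) ≤ C) {ξ : GromovBoundary dist}
    (hx : Tendsto (fun n => of (x n)) atTop (𝓝 (bdry ξ)))
    (hclosed : ∀ φ : ℕ → ℕ, StrictMono φ →
      IsClosed (insert (bdry ξ) (range fun n => of (x (φ n))))) :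
    Tendsto (fun n => of (y n)) atTop (𝓝 (bdry ξ)) := by
  by_contra hy
  rw [tendsto_nhds] at hy
  push Not at hy
  obtain ⟨S, hS, hξ, hfreq⟩ := hy
  obtain ⟨φ, hφ, hφS⟩ := extraction_of_frequently_atTop (not_eventually.1 hfreq)
  -- The sets `{p | (p | ξ)_o > t}` are not known to be neighbourhoods of `ξ`, so convergence of `x`
  -- does not directly make its Gromov products with `ξ` large. Instead, if all `y (φ n)` avoid `S`,
  -- then the `x (φ n)` have bounded product with `ξ`, so removing them leaves an open set around
  -- `ξ`; this contradicts the convergence of `x`.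
  have hT := (hclosed φ hφ).isOpen_compl
  set T := (insert (bdry ξ) (range fun n => of (x (φ n))))ᶜ with hTdef
  have hopen : IsOpen (insert (bdry ξ) T) := by
    refine ⟨fun z hz => ?_, fun η hη o => ?_⟩
    · obtain ⟨ε, hε, h⟩ := hT.1 z (hz.resolve_left (by simp))
      exact ⟨ε, hε, fun w hw => Or.inr (h w hw)⟩
    · by_cases hηξ : η = ξ
      · subst hηξ
        obtain ⟨t, ht, h⟩ := hS.2 η hξ o
        -- `C` pays for passing from `x` to `y`; the extra `1` restores the strict inequality lost
        -- in `prod_of_le_add`.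
        refine ⟨max 0 (t + 1 + C), le_max_left _ _, fun p hp => ?_⟩
        by_contra hpT
        rw [mem_insert_iff, not_or, hTdef, notMem_compl_iff] at hpT
        obtain ⟨n, rfl⟩ := hpT.2.resolve_left hpT.1
        refine hφS n (h _ (lt_of_lt_of_le ?_ (prod_of_le_add htri (hC (φ n)) (bdry η)
          (lt_of_le_of_lt (EReal.coe_le_coe_iff.2 (le_max_right 0 (t + 1 + C))) hp))))
        exact EReal.coe_lt_coe_iff.2 (lt_add_one t)
      · obtain ⟨t, ht, h⟩ := hT.2 η (hη.resolve_left (by simpa using hηξ)) o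
        exact ⟨t, ht, fun p hp => Or.inr (h p hp)⟩
  have hev := (hx.comp hφ.tendsto_atTop).eventually (hopen.mem_nhds (mem_insert _ _))
  obtain ⟨n, hn⟩ := hev.exists
  rcases hn with hn | hn
  · simp at hn
  · exact hn (Or.inr ⟨n, rfl⟩)

end Gromov

/-! ### The end compactification -/

namespace EndCompactification

variable {Y : Type*} [TopologicalSpace Y]

theorem continuous_of : Continuous (of : Y → EndCompactification Y) :=
  continuous_def.2 fun _ hS => hS.1

theorem of_injective : Function.Injective (of : Y → EndCompactification Y) :=
  fun _ _ h => by injection h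

theorem isOpen_image_of {U : Set Y} (hU : IsOpen U) : IsOpen (of '' U) := by
  refine ⟨?_, fun e he => ?_⟩
  · change IsOpen (of ⁻¹' (of '' U))
    rwa [preimage_image_eq _ of_injective]
  · obtain ⟨y, -, h⟩ := he
    cases h

/-- The neighbourhood of an end given by `K` itself misses `K`. -/
theorem isClosed_image_of [T2Space Y] {K : Set Y} (hK : IsCompact K) : IsClosed (of '' K) := by
  refine ⟨⟨?_, fun e _ => ⟨⟨K, hK⟩, ?_⟩⟩⟩
  · change IsOpen (of ⁻¹' (of '' K)ᶜ)
    rw [preimage_compl, preimage_image_eq _ of_injective]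
    exact hK.isClosed.isOpen_compl
  · rintro _ (⟨y, hy, rfl⟩ | ⟨e', -, rfl⟩) ⟨k, hk, h⟩
    · obtain rfl := of_injective h
      obtain ⟨y₀, -, he⟩ := e.2.1 ⟨K, hK⟩
      rw [he] at hy
      exact connectedComponentIn_subset _ _ hy hk
    · cases h

end EndCompactification

theorem IdExtendsGromovToEnd.limit_eq {d : ℕ} {Ω : Set (Cn d)} (hΩ : IsDomainIn Ω)
    (hext : IdExtendsGromovToEnd Ω) {x y : ℕ → Ω} {C : ℝ}
    (hC : ∀ n, kobayashiDist Ω (y n) (x n) ≤ C) {p q : Cn d} (hp : p ∈ frontier Ω)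
    (hx : Tendsto (fun n => (x n : Cn d)) atTop (𝓝 p))
    (hy : Tendsto (fun n => (y n : Cn d)) atTop (𝓝 q)) : p = q := by
  obtain ⟨h, hh⟩ := hext
  have hpc : p ∈ closure Ω := frontier_subset_closure hp
  have hqc : q ∈ closure Ω :=
    mem_closure_of_tendsto hy (Eventually.of_forall fun n => (y n).2)
  set ι : Ω → closure Ω := fun z => ⟨z, subset_closure z.2⟩ with hι
  have hxY : Tendsto (fun n => ι (x n)) atTop (𝓝 ⟨p, hpc⟩) := tendsto_subtype_rng.2 hx
  have hyY : Tendsto (fun n => ι (y n)) atTop (𝓝 ⟨q, hqc⟩) := tendsto_subtype_rng.2 hy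
  have hsymm (z : Ω) : h.symm (EndCompactification.of (ι z)) = GromovCompactification.of z := by
    rw [h.symm_apply_eq, hh]
  -- The homeomorphism is the identity on `Ω`, so a point outside `Ω` must come from the Gromov
  -- boundary.
  obtain ⟨ξ, hξ⟩ : ∃ ξ, h.symm (EndCompactification.of ⟨p, hpc⟩) =
      GromovCompactification.bdry ξ := by
    rcases hcase : h.symm (EndCompactification.of ⟨p, hpc⟩) with z | ξ
    · rw [h.symm_apply_eq, hh] at hcase
      have : p = z := congrArg Subtype.val (EndCompactification.of_injective hcase)
      rw [hΩ.1.frontier_eq] at hp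
      exact absurd (this ▸ z.2 : p ∈ Ω) hp.2
    · exact ⟨ξ, rfl⟩
  have hlim : Tendsto (fun n => GromovCompactification.of (x n)) atTop
      (𝓝 (GromovCompactification.bdry ξ : GromovCompactification (kobayashiDist Ω))) := by
    rw [← hξ]
    simp_rw [← hsymm]
    exact ((h.symm.continuous.comp EndCompactification.continuous_of).tendsto _).comp hxY
  have hlim' := GromovCompactification.tendsto_of_dist_le hΩ.kobayashiDist_triangle hC hlim
    fun φ hφ => by
      -- A convergent sequence together with its limit is compact, hence closed in the end
      -- compactification.
      have hK := EndCompactification.isClosed_image_of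
        (hxY.comp hφ.tendsto_atTop).isCompact_insert_range
      have := h.symm.isClosed_image.2 hK
      rw [image_insert_eq, image_insert_eq, hξ, ← range_comp, ← range_comp] at this
      simpa only [Function.comp_def, hsymm] using this
  have hlimY : Tendsto (fun n => EndCompactification.of (ι (y n))) atTop
      (𝓝 (EndCompactification.of ⟨p, hpc⟩)) := by
    rw [h.symm_apply_eq.1 hξ]
    have hι' : (fun n => EndCompactification.of (ι (y n))) =
        fun n => h (GromovCompactification.of (y n)) := funext fun n => (hh (y n)).symm
    rw [hι']
    exact (h.continuous.tendsto _).comp hlim'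
  have : Tendsto (fun n => ι (y n)) atTop (𝓝 ⟨p, hpc⟩) := by
    rw [tendsto_nhds]
    intro U hU hpU
    filter_upwards [hlimY.eventually
      ((EndCompactification.isOpen_image_of hU).mem_nhds ⟨_, hpU, rfl⟩)] with n hn
    obtain ⟨u, hu, hu'⟩ := hn
    obtain rfl := EndCompactification.of_injective hu'
    exact hu
  exact congrArg Subtype.val (tendsto_nhds_unique this hyY)

/-! ### Discs in the boundary -/

/-- A boundary point of a `C⁰` domain has a neighbourhood in which the boundary is moved into the
domain by small translations in a fixed direction. -/
theorem IsC0Domain.exists_inward_translation {d : ℕ} {Ω : Set (Cn d)} (hΩ : IsC0Domain Ω)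
    {x : Cn d} (hx : x ∈ frontier Ω) : ∃ (v : Cn d) (W : Set (Cn d)) (r : ℝ), W ∈ 𝓝 x ∧ 0 < r ∧
      ∀ z ∈ W, z ∈ frontier Ω → ∀ s : ℝ, 0 < s → s < r → z + (s : ℂ) • v ∈ Ω := by
  obtain ⟨U, Ψ, N, φ, hU, hxU, hN, -, hφ, hUΩ⟩ := hΩ.2 x hx
  -- Moving along `v` raises only `Im w_d`, leaving the argument of `φ` unchanged.
  set v : Cn d := Ψ.symm (WithLp.toLp 2 (0, Complex.I)) with hv
  have hΨv : Ψ v = WithLp.toLp 2 (0, Complex.I) := by simp [hv]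
  have hvn : ‖v‖ = 1 := by
    rw [hv, LinearIsometryEquiv.norm_map]
    simp
  obtain ⟨ρ, hρ, hball⟩ := Metric.isOpen_iff.1 hU x hxU
  refine ⟨v, Metric.ball x (ρ / 2), ρ / 2, Metric.ball_mem_nhds _ (half_pos hρ), half_pos hρ,
    fun z hz hzΩ s hs hsρ => ?_⟩
  have hzU : z ∈ U := hball (Metric.ball_subset_ball (by linarith) hz)
  have hzsU : z + (s : ℂ) • v ∈ U := by
    apply hball
    rw [mem_ball_iff_norm] at hz ⊢
    calc ‖z + (s : ℂ) • v - x‖ = ‖(z - x) + (s : ℂ) • v‖ := by congr 1; abel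
      _ ≤ ‖z - x‖ + ‖(s : ℂ) • v‖ := norm_add_le _ _
      _ < ρ / 2 + ρ / 2 := by
        rw [norm_smul, hvn, mul_one, Complex.norm_real, Real.norm_of_nonneg hs.le]
        exact add_lt_add hz hsρ
      _ = ρ := add_halves ρ
  set c : Cn d → Cn (d - 1) × ℝ := fun z => ((Ψ (z - x)).fst, (Ψ (z - x)).snd.re) with hc
  have hcc : Continuous c := by
    have h0 : Continuous fun z => Ψ (z - x) := by fun_prop
    have h1 : Continuous fun z => (Ψ (z - x)).fst := by fun_prop
    have h2 : Continuous fun z => (Ψ (z - x)).snd := by fun_prop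
    exact h1.prodMk (Complex.continuous_re.comp h2)
  have him : Continuous fun z => (Ψ (z - x)).snd.im := by
    have h2 : Continuous fun z => (Ψ (z - x)).snd := by fun_prop
    exact Complex.continuous_im.comp h2
  -- The strict inequality on `Ω` passes to the closure as a weak one; adding `s > 0` makes it
  -- strict again.
  have hle : φ (c z) ≤ (Ψ (z - x)).snd.im := by
    have hne : (𝓝[Ω] z).NeBot := mem_closure_iff_nhdsWithin_neBot.1 (frontier_subset_closure hzΩ)
    have hφz : ContinuousAt φ (c z) := hφ.continuousAt (hN.mem_nhds (hUΩ z hzU).1)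
    refine le_of_tendsto_of_tendsto (b := 𝓝[Ω] z)
      ((hφz.comp hcc.continuousAt).tendsto.mono_left nhdsWithin_le_nhds)
      (him.continuousAt.tendsto.mono_left nhdsWithin_le_nhds) ?_
    filter_upwards [self_mem_nhdsWithin, mem_nhdsWithin_of_mem_nhds (hU.mem_nhds hzU)] with w hw hwU
    exact ((hUΩ w hwU).2.1 hw).le
  have hΨ : Ψ (z + (s : ℂ) • v - x) = Ψ (z - x) + (s : ℂ) • WithLp.toLp 2 (0, Complex.I) := by
    rw [add_sub_right_comm, map_add, map_smul, hΨv]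
  rw [(hUΩ _ hzsU).2, hΨ]
  simp only [hc] at hle
  generalize Ψ (z - x) = w at hle ⊢
  have hlt : φ (w.fst, w.snd.re) < w.snd.im + s := by linarith
  simpa using hlt

/-- A variety of positive dimension contains a nonconstant disc near some of its points. -/
theorem exists_disc_of_varietyDim_pos {d : ℕ} {V : Set (Cn d)} (hV : 0 < varietyDim V) :
    ∃ p ∈ V, ∀ W ∈ 𝓝 p, ∃ g : ℂ → Cn d, DifferentiableOn ℂ g (Metric.ball 0 1) ∧
      MapsTo g (Metric.ball 0 1) (V ∩ W) ∧ g 0 ≠ g (1 / 2) := by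
  simp only [varietyDim, lt_iSup_iff] at hV
  obtain ⟨p, k, ⟨hpV, Φ, L, hpΦ, -, hΦs, hk, hΦV⟩, hpos⟩ := hV
  have hk0 : k ≠ 0 := by rintro rfl; simp at hpos
  obtain ⟨v, hvL, hv0⟩ := L.exists_mem_ne_zero_of_ne_bot (by
    rintro rfl
    exact hk0 (by rw [← hk]; simp))
  refine ⟨p, hpV, fun W hW => ?_⟩
  have hcont : ContinuousAt Φ.symm (Φ p) := Φ.symm.continuousAt (Φ.map_source hpΦ)
  have hnhds : Φ.target ∩ Φ.symm ⁻¹' W ∈ 𝓝 (Φ p) :=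
    inter_mem (Φ.open_target.mem_nhds (Φ.map_source hpΦ))
      (hcont (by rwa [Φ.left_inv hpΦ]))
  obtain ⟨ρ, hρ, hball⟩ := Metric.mem_nhds_iff.1 hnhds
  have hvn : 0 < ‖v‖ := norm_pos_iff.2 hv0
  -- With this scaling the unit disc in the direction `v` of `L` fits in the ball of radius `ρ`
  -- around `Φ p`. Its image under `Φ.symm` lies in `V`, and injectivity separates the parameters
  -- `0` and `1 / 2`.
  set c : ℂ := ((ρ / ‖v‖ : ℝ) : ℂ) with hc
  have hc0 : c ≠ 0 := by
    rw [hc, Complex.ofReal_ne_zero]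
    positivity
  have hmaps : MapsTo (fun ζ : ℂ => Φ p + (ζ * c) • v) (Metric.ball 0 1)
      (Φ.target ∩ Φ.symm ⁻¹' W) := by
    intro ζ hζ
    apply hball
    rw [mem_ball_zero_iff] at hζ
    rw [mem_ball_iff_norm, add_sub_cancel_left, norm_smul, norm_mul, hc, Complex.norm_real,
      Real.norm_of_nonneg (by positivity), mul_assoc, div_mul_cancel₀ _ hvn.ne']
    nlinarith
  refine ⟨fun ζ => Φ.symm (Φ p + (ζ * c) • v), ?_, fun ζ hζ => ⟨?_, (hmaps hζ).2⟩, fun h => ?_⟩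
  · exact hΦs.comp (by fun_prop) fun ζ hζ => (hmaps hζ).1
  · rw [hΦV _ (Φ.map_target (hmaps hζ).1), Φ.right_inv (hmaps hζ).1]
    exact L.add_mem ((hΦV p hpΦ).1 hpV) (L.smul_mem _ hvL)
  · have := Φ.symm.injOn (hmaps (by simp : (0 : ℂ) ∈ Metric.ball (0 : ℂ) 1)).1
      (hmaps (by norm_num : (1 / 2 : ℂ) ∈ Metric.ball (0 : ℂ) 1)).1 h
    simp [hc0, hv0] at this

theorem theorem1p6 (d : ℕ) (Ω : Set (Cn d)) (hΩ : IsC0Domain Ω)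
    (hhyp : IsKobayashiHyperbolic Ω)
    (hGromov : IsGromovHyperbolic (kobayashiDist Ω))
    (hext : IdExtendsGromovToEnd Ω) :
    ¬ ∃ U V : Set (Cn d), IsComplexSubvariety U V ∧ 0 < varietyDim V ∧ V ⊆ frontier Ω := by
  rintro ⟨U, V, -, hdim, hVΩ⟩
  obtain ⟨p, hpV, hdisc⟩ := exists_disc_of_varietyDim_pos hdim
  obtain ⟨v, W, r, hW, hr, htrans⟩ := hΩ.exists_inward_translation (hVΩ hpV)
  obtain ⟨g, hg, hgV, hne⟩ := hdisc W hW
  obtain ⟨s, -, hs, hs0⟩ := exists_seq_strictAnti_tendsto' hr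
  have hf (n : ℕ) : IsHolomorphicDisc Ω fun ζ => g ζ + (s n : ℂ) • v :=
    ⟨hg.add_const _, fun ζ hζ =>
      htrans _ (hgV hζ).2 (hVΩ (hgV hζ).1) _ (hs n).1 (hs n).2⟩
  have h0 : (0 : ℂ) ∈ Metric.ball (0 : ℂ) 1 := by simp
  have h1 : (1 / 2 : ℂ) ∈ Metric.ball (0 : ℂ) 1 := by norm_num
  have hlim (ζ : ℂ) : Tendsto (fun n => g ζ + (s n : ℂ) • v) atTop (𝓝 (g ζ)) := by
    have : Tendsto (fun n => (s n : ℂ)) atTop (𝓝 ((0 : ℝ) : ℂ)) :=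
      (Complex.continuous_ofReal.tendsto 0).comp hs0
    simpa using (this.smul_const v).const_add (g ζ)
  -- For each `n` the two points lie on one disc at fixed parameters, so the distance bound is
  -- independent of `n`.
  exact hne (hext.limit_eq hΩ.1 (x := fun n => ⟨_, (hf n).2 h0⟩) (y := fun n => ⟨_, (hf n).2 h1⟩)
    (fun n => kobayashiDist_le ((hf n).isDiscChainLength h1 h0)) (hVΩ (hgV h0).1)
    (hlim 0) (hlim (1 / 2)))
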